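/- Let $K\ge 0$ and $d\ge 1$ be integers, and let $\mathbf X_1,\dots,\mathbf X_K$ be independent random Hermitian $d\times d$ complex matrices on a probability space. For Hermitian matrices write $\mathbf A\preceq\mathbf B$ if $\mathbf B-\mathbf A$ is positive semidefinite, and let $\lambda_{\max}$ and $\lambda_{\min}$ denote the largest and the smallest eigenvalue. Assume that there are a function $g:(0,\infty)\to\mathbb R$ and fixed Hermitian $d\times d$ matrices $\mathbf A_1,\dots,\mathbf A_K$ such that, for every $\theta>0$ and every $k$, the (entrywise) expectation $\mathbb E\,e^{-\theta\mathbf X_k}$ exists and $$\mathbb E\,e^{-\theta \mathbf X_k}\preceq e^{g(\theta)\mathbf A_k}.$$ (i) If $g(\theta)>0$ for all $\theta>0$, then for every $\epsilon>0$, $$\mathbb P\Big\{\lambda_{\max}\Big(\sum_{k}\mathbf X_k\Big)\le\epsilon\Big\}\le\inf_{\theta>0}\exp\Big(\theta\epsilon+g(\theta)\,\lambda_{\max}\Big(\sum_{k}\mathbf A_k\Big)\Big).$$ (ii) If $g(\theta)<0$ for all $\theta>0$, then for every $\epsilon>0$, $$\mathbb P\Big\{\lambda_{\max}\Big(\sum_{k}\mathbf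 X_k\Big)\le\epsilon\Big\}\le\inf_{\theta>0}\exp\Big(\theta\epsilon+g(\theta)\,\lambda_{\min}\Big(\sum_{k}\mathbf A_k\Big)\Big).$$ -/

import Mathlib

open MeasureTheory ProbabilityTheory
open scoped MatrixOrder

namespace RandomMatrix

/-- The product (equivalently, Borel) sigma-algebra of the entries. -/
noncomputable instance matrixMeasurableSpace {d : ℕ} : MeasurableSpace (Matrix (Fin d) (Fin d) ℂ) :=
  MeasurableSpace.pi (X := fun _ : Fin d => Fin d → ℂ)

/-- The largest eigenvalue of a Hermitian matrix. -/
noncomputable def lambdaMax {d : ℕ} (A : Matrix (Fin d) (Fin d) ℂ) : ℝ :=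
  sSup (spectrum ℝ A)

/-- The smallest eigenvalue of a Hermitian matrix. -/
noncomputable def lambdaMin {d : ℕ} (A : Matrix (Fin d) (Fin d) ℂ) : ℝ :=
  sInf (spectrum ℝ A)

theorem spectrum_finite_nonempty {d : ℕ} (hd : 0 < d) {A : Matrix (Fin d) (Fin d) ℂ}
    (hA : A.IsHermitian) : (spectrum ℝ A).Finite ∧ (spectrum ℝ A).Nonempty := by
  have : Nonempty (Fin d) := ⟨⟨0, hd⟩⟩
  rw [hA.spectrum_real_eq_range_eigenvalues]
  exact ⟨Set.finite_range _, Set.range_nonempty _⟩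

/-- On Hermitian matrices of positive size the supremum is attained. -/
theorem isGreatest_lambdaMax {d : ℕ} (hd : 0 < d) {A : Matrix (Fin d) (Fin d) ℂ}
    (hA : A.IsHermitian) : IsGreatest (spectrum ℝ A) (lambdaMax A) :=
  have h := spectrum_finite_nonempty hd hA
  ⟨h.2.csSup_mem h.1, fun _ hx => le_csSup h.1.bddAbove hx⟩

/-- On Hermitian matrices of positive size the infimum is attained. -/
theorem isLeast_lambdaMin {d : ℕ} (hd : 0 < d) {A : Matrix (Fin d) (Fin d) ℂ}
    (hA : A.IsHermitian) : IsLeast (spectrum ℝ A) (lambdaMin A) :=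
  have h := spectrum_finite_nonempty hd hA
  ⟨h.2.csInf_mem h.1, fun _ hx => csInf_le h.1.bddBelow hx⟩

/-- A random matrix has an expectation when all its entries are integrable. -/
def HasExpectation {Ω : Type*} [MeasurableSpace Ω] (μ : Measure Ω) {d : ℕ}
    (Y : Ω → Matrix (Fin d) (Fin d) ℂ) : Prop :=
  ∀ i j, Integrable (fun ω => Y ω i j) μ

/-- The entrywise expectation of a random matrix. -/
noncomputable def expectation {Ω : Type*} [MeasurableSpace Ω] (μ : Measure Ω) {d : ℕ}
    (Y : Ω → Matrix (Fin d) (Fin d) ℂ) : Matrix (Fin d) (Fin d) ℂ :=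
  Matrix.of fun i j => ∫ ω, Y ω i j ∂μ

end RandomMatrix

/-! Fix `θ > 0`. If `λ_max(∑ X_k) ≤ ε`, all `d` eigenvalues of `-θ ∑ X_k` are at least `-θε`, so `tr
exp(-θ ∑ X_k) ≥ d e^{-θε}`, and Markov's inequality applies. The mean of this trace is at most `tr
exp(∑ log E e^{-θ X_k})` (`lintegral_trace_exp_sum_le`). Since the logarithm is operator monotone
and `tr exp` is monotone, this is at most `d e^c` whenever `g(θ) ∑ A_k ⪯ c I`. The factors `d`
cancel, and the sign of `g` decides whether `c` comes from `λ_max` or `λ_min`.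

Subadditivity rests on Lieb's theorem that `A ↦ tr exp(H + log A)` is concave, used through Jensen's
inequality one summand at a time. By the Gibbs principle this trace is the maximum over `T` of `tr
TH + tr T - D(T‖A)`, where `D(T‖A) = tr T log T - tr T log A`; so joint convexity of `D` suffices.
That follows from `D(T‖A) = ∫₀^∞ (⟨T, (R_A + t L_T)⁻¹ T⟩ - tr T / (1 + t)) dt`, whose quadratic form
is a supremum of functionals linear in `(T, A)`. -/

section TraceInequalities

open Matrix Filter Topology
open scoped Matrix.Norms.L2Operator ComplexOrder

variable {n : Type*} [Fintype n] [DecidableEq n]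

/-! ### Traces as double sums over two eigenbases; Klein's inequality -/

namespace Matrix.IsHermitian

/-- The squared moduli of the inner products between two eigenbases. -/
noncomputable def overlap {T A : Matrix n n ℂ} (hT : T.IsHermitian) (hA : A.IsHermitian)
    (i j : n) : ℝ :=
  ‖(star (hT.eigenvectorUnitary : Matrix n n ℂ) * (hA.eigenvectorUnitary : Matrix n n ℂ)) i j‖ ^ 2

theorem overlap_nonneg {T A : Matrix n n ℂ} (hT : T.IsHermitian) (hA : A.IsHermitian) (i j : n) :
    0 ≤ hT.overlap hA i j := by
  unfold overlap; positivity

theorem re_trace_diagonal_mul_diagonal_mul_conjTranspose (a b : n → ℝ) (W : Matrix n n ℂ) :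
    (trace (diagonal (fun i => (a i : ℂ)) * W * diagonal (fun i => (b i : ℂ)) * Wᴴ)).re =
      ∑ i, ∑ j, ‖W i j‖ ^ 2 * a i * b j := by
  simp only [trace, diag_apply, Complex.re_sum]
  refine Finset.sum_congr rfl fun i _ => ?_
  rw [mul_apply, Complex.re_sum]
  refine Finset.sum_congr rfl fun j _ => ?_
  rw [mul_diagonal, diagonal_mul, conjTranspose_apply]
  have : (a i : ℂ) * W i j * (b j : ℂ) * star (W i j) = ((‖W i j‖ ^ 2 * a i * b j : ℝ) : ℂ) := by
    have h := Complex.mul_conj' (W i j)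
    push_cast
    rw [← h, Complex.star_def]
    ring
  rw [this, Complex.ofReal_re]

theorem cfc_eq_mul {A : Matrix n n ℂ} (hA : A.IsHermitian) (f : ℝ → ℝ) :
    cfc f A = (hA.eigenvectorUnitary : Matrix n n ℂ) *
      diagonal (fun i => ((f (hA.eigenvalues i) : ℝ) : ℂ)) *
      (hA.eigenvectorUnitary : Matrix n n ℂ)ᴴ := by
  rw [hA.cfc_eq, IsHermitian.cfc, Unitary.conjStarAlgAut_apply]
  rfl

/-- Cyclicity of the trace leaves `U* V` between two diagonal matrices. As the weights are
nonnegative, trace inequalities reduce to scalar ones in a pair of eigenvalues. -/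
theorem re_trace_cfc_mul_cfc {T A : Matrix n n ℂ} (hT : T.IsHermitian) (hA : A.IsHermitian)
    (f g : ℝ → ℝ) :
    (trace (cfc f T * cfc g A)).re =
      ∑ i, ∑ j, hT.overlap hA i j * f (hT.eigenvalues i) * g (hA.eigenvalues j) := by
  unfold overlap
  rw [← re_trace_diagonal_mul_diagonal_mul_conjTranspose, hT.cfc_eq_mul, hA.cfc_eq_mul,
    star_eq_conjTranspose, conjTranspose_mul, conjTranspose_conjTranspose]
  simp only [mul_assoc]
  rw [trace_mul_comm]
  simp only [mul_assoc]

/-- Summing over both eigenbases even here lets all the traces in Klein's inequality be compared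
term by term. -/
theorem re_trace_left {T A : Matrix n n ℂ} (hT : T.IsHermitian) (hA : A.IsHermitian) :
    (trace T).re = ∑ i, ∑ j, hT.overlap hA i j * hT.eigenvalues i := by
  have h := hT.re_trace_cfc_mul_cfc hA id 1
  rw [cfc_id ℝ T hT.isSelfAdjoint, Pi.one_def, cfc_const_one ℝ A hA.isSelfAdjoint, mul_one] at h
  simpa using h

theorem re_trace_right {T A : Matrix n n ℂ} (hT : T.IsHermitian) (hA : A.IsHermitian) :
    (trace A).re = ∑ i, ∑ j, hT.overlap hA i j * hA.eigenvalues j := by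
  have h := hT.re_trace_cfc_mul_cfc hA 1 id
  rw [cfc_id ℝ A hA.isSelfAdjoint, Pi.one_def, cfc_const_one ℝ T hT.isSelfAdjoint, one_mul] at h
  simpa using h

theorem re_trace_mul_log {T A : Matrix n n ℂ} (hT : T.IsHermitian) (hA : A.IsHermitian) :
    (trace (T * CFC.log A)).re =
      ∑ i, ∑ j, hT.overlap hA i j * (hT.eigenvalues i * Real.log (hA.eigenvalues j)) := by
  have h := hT.re_trace_cfc_mul_cfc hA id Real.log
  rw [cfc_id ℝ T hT.isSelfAdjoint] at h
  simpa [CFC.log, mul_assoc] using h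

theorem re_trace_mul_log_self {T A : Matrix n n ℂ} (hT : T.IsHermitian) (hA : A.IsHermitian) :
    (trace (T * CFC.log T)).re =
      ∑ i, ∑ j, hT.overlap hA i j * (hT.eigenvalues i * Real.log (hT.eigenvalues i)) := by
  have h := hT.re_trace_cfc_mul_cfc hA (fun x => x * Real.log x) 1
  have hc : ∀ f : ℝ → ℝ, ContinuousOn f (spectrum ℝ T) := fun f =>
    (hT.spectrum_real_eq_range_eigenvalues ▸ Set.finite_range _ :
      (spectrum ℝ T).Finite).continuousOn f
  rw [cfc_mul (fun x => x) Real.log T (hc _) (hc _), cfc_id' ℝ T hT.isSelfAdjoint, Pi.one_def,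
    cfc_const_one ℝ A hA.isSelfAdjoint, mul_one] at h
  simpa [CFC.log] using h

end Matrix.IsHermitian

/-- **Klein's inequality** for the entropy function. -/
theorem Matrix.PosDef.klein {T M : Matrix n n ℂ} (hT : T.PosDef) (hM : M.PosDef) :
    (trace (T * CFC.log M)).re - (trace (T * CFC.log T)).re + (trace T).re ≤ (trace M).re := by
  rw [hT.1.re_trace_mul_log hM.1, hT.1.re_trace_mul_log_self hM.1, hT.1.re_trace_left hM.1,
    hT.1.re_trace_right hM.1]
  simp only [← Finset.sum_sub_distrib, ← Finset.sum_add_distrib]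
  refine Finset.sum_le_sum fun i _ => Finset.sum_le_sum fun j _ => ?_
  have hτ := hT.eigenvalues_pos i
  have hμ := hM.eigenvalues_pos j
  have hw := hT.1.overlap_nonneg hM.1 i j
  -- Multiplied by `τ`, `log x ≤ x - 1` at `x = μ / τ` is the scalar Klein inequality.
  have h := Real.log_le_sub_one_of_pos (div_pos hμ hτ)
  rw [Real.log_div hμ.ne' hτ.ne'] at h
  have h2 := mul_le_mul_of_nonneg_left h hτ.le
  have h3 : hT.1.eigenvalues i * (hM.1.eigenvalues j / hT.1.eigenvalues i - 1) =
      hM.1.eigenvalues j - hT.1.eigenvalues i := by field_simp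
  rw [h3] at h2
  nlinarith [mul_le_mul_of_nonneg_left h2 hw]

/-! ### Resolvent form and joint convexity of relative entropy -/

namespace Matrix.IsHermitian

/-- The quadratic form `⟨T, (R_A + t L_T)⁻¹ T⟩` built from left and right multiplication. -/
noncomputable def resolventForm {T A : Matrix n n ℂ} (hT : T.IsHermitian) (hA : A.IsHermitian)
    (t : ℝ) : ℝ :=
  ∑ i, ∑ j, hT.overlap hA i j * (hT.eigenvalues i ^ 2 / (hA.eigenvalues j + t * hT.eigenvalues i))

/-- The affine functional of `(T, A)` whose supremum over `Z` is the resolvent form. -/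
noncomputable def _root_.Matrix.resolventFunctional (t : ℝ) (Z T A : Matrix n n ℂ) : ℝ :=
  2 * (trace (Zᴴ * T)).re - (trace (Zᴴ * Z * A)).re - t * (trace (Zᴴ * T * Z)).re

/-- In the coordinates `Z = U B V*` the functional decouples into one scalar quadratic per entry of
`B`. -/
theorem resolventFunctional_eq {T A : Matrix n n ℂ} (hT : T.IsHermitian) (hA : A.IsHermitian)
    (t : ℝ) (B : Matrix n n ℂ) :
    resolventFunctional t ((hT.eigenvectorUnitary : Matrix n n ℂ) * B *
        (hA.eigenvectorUnitary : Matrix n n ℂ)ᴴ) T A =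
      ∑ i, ∑ j, (2 * (star (B i j) * hT.eigenvalues i *
        (star (hT.eigenvectorUnitary : Matrix n n ℂ) * (hA.eigenvectorUnitary : Matrix n n ℂ)) i j
        ).re - (hA.eigenvalues j + t * hT.eigenvalues i) * ‖B i j‖ ^ 2) := by
  set U := (hT.eigenvectorUnitary : Matrix n n ℂ)
  set V := (hA.eigenvectorUnitary : Matrix n n ℂ)
  have hUU : Uᴴ * U = 1 := Unitary.coe_star_mul_self hT.eigenvectorUnitary
  have hVV : Vᴴ * V = 1 := Unitary.coe_star_mul_self hA.eigenvectorUnitary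
  have hTe : T = U * diagonal (fun i => ((hT.eigenvalues i : ℝ) : ℂ)) * Uᴴ := by
    rw [← hT.cfc_eq_mul (fun x => x), cfc_id' ℝ T hT.isSelfAdjoint]
  have hAe : A = V * diagonal (fun i => ((hA.eigenvalues i : ℝ) : ℂ)) * Vᴴ := by
    rw [← hA.cfc_eq_mul (fun x => x), cfc_id' ℝ A hA.isSelfAdjoint]
  set τ := hT.eigenvalues
  set α := hA.eigenvalues
  have hUU' : ∀ X : Matrix n n ℂ, Uᴴ * (U * X) = X := fun X => by rw [← mul_assoc, hUU, one_mul]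
  have hVV' : ∀ X : Matrix n n ℂ, Vᴴ * (V * X) = X := fun X => by rw [← mul_assoc, hVV, one_mul]
  have e1 : (trace ((U * B * Vᴴ)ᴴ * T)).re =
      ∑ i, ∑ j, (star (B i j) * τ i * (star U * V) i j).re := by
    have : trace ((U * B * Vᴴ)ᴴ * T) =
        trace (Bᴴ * (diagonal (fun i => ((τ i : ℝ) : ℂ)) * (Uᴴ * V))) := by
      conv_lhs => rw [hTe]
      simp only [conjTranspose_mul, conjTranspose_conjTranspose, mul_assoc, hUU']
      rw [trace_mul_comm]
      simp only [mul_assoc]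
    rw [this, Finset.sum_comm]
    simp only [trace, diag_apply, mul_apply (M := Bᴴ), diagonal_mul, conjTranspose_apply,
      Complex.re_sum, star_eq_conjTranspose, mul_assoc]
  have e2 : (trace ((U * B * Vᴴ)ᴴ * (U * B * Vᴴ) * A)).re =
      ∑ i, ∑ j, α j * ‖B i j‖ ^ 2 := by
    -- The identity is written as a diagonal of ones to fit
    -- `re_trace_diagonal_mul_diagonal_mul_conjTranspose`.
    have : trace ((U * B * Vᴴ)ᴴ * (U * B * Vᴴ) * A) =
        trace (diagonal (fun i => (((1 : n → ℝ) i : ℝ) : ℂ)) * B *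
          diagonal (fun i => ((α i : ℝ) : ℂ)) * Bᴴ) := by
      conv_lhs => rw [hAe]
      simp only [conjTranspose_mul, conjTranspose_conjTranspose, mul_assoc, hUU', hVV']
      rw [trace_mul_comm]
      simp only [mul_assoc, hVV, mul_one]
      rw [trace_mul_comm]
      simp [mul_assoc]
    rw [this, re_trace_diagonal_mul_diagonal_mul_conjTranspose]
    simp [mul_comm]
  have e3 : (trace ((U * B * Vᴴ)ᴴ * T * (U * B * Vᴴ))).re =
      ∑ i, ∑ j, τ i * ‖B i j‖ ^ 2 := by
    have : trace ((U * B * Vᴴ)ᴴ * T * (U * B * Vᴴ)) =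
        trace (diagonal (fun i => ((τ i : ℝ) : ℂ)) * B *
          diagonal (fun i => (((1 : n → ℝ) i : ℝ) : ℂ)) * Bᴴ) := by
      conv_lhs => rw [hTe]
      simp only [conjTranspose_mul, conjTranspose_conjTranspose, mul_assoc, hUU']
      rw [trace_mul_comm]
      simp only [mul_assoc, hVV, mul_one]
      rw [trace_mul_comm]
      simp [mul_assoc]
    rw [this, re_trace_diagonal_mul_diagonal_mul_conjTranspose]
    simp [mul_comm]
  rw [resolventFunctional, e1, e2, e3]
  simp only [Finset.mul_sum, ← Finset.sum_sub_distrib]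
  refine Finset.sum_congr rfl fun i _ => Finset.sum_congr rfl fun j _ => ?_
  ring

end Matrix.IsHermitian

/-- With `c = α + tτ > 0`, completing the square bounds each term `2 Re(b̄ τ m) - c|b|²` by
`τ²|m|²/c`. -/
theorem Matrix.PosDef.resolventFunctional_le {T A : Matrix n n ℂ} (hT : T.PosDef) (hA : A.PosDef)
    {t : ℝ} (ht : 0 ≤ t) (Z : Matrix n n ℂ) :
    resolventFunctional t Z T A ≤ hT.1.resolventForm hA.1 t := by
  set U := (hT.1.eigenvectorUnitary : Matrix n n ℂ)
  set V := (hA.1.eigenvectorUnitary : Matrix n n ℂ)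
  have hUU : U * Uᴴ = 1 := Unitary.coe_mul_star_self hT.1.eigenvectorUnitary
  have hVV : V * Vᴴ = 1 := Unitary.coe_mul_star_self hA.1.eigenvectorUnitary
  have hZ : Z = U * (Uᴴ * Z * V) * Vᴴ := by
    rw [mul_assoc, mul_assoc, hVV, mul_one, ← mul_assoc, hUU, one_mul]
  rw [hZ, hT.1.resolventFunctional_eq hA.1, IsHermitian.resolventForm]
  refine Finset.sum_le_sum fun i _ => Finset.sum_le_sum fun j _ => ?_
  have hτ := hT.eigenvalues_pos i
  have hα := hA.eigenvalues_pos j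
  unfold IsHermitian.overlap
  generalize (star (hT.1.eigenvectorUnitary : Matrix n n ℂ) *
    (hA.1.eigenvectorUnitary : Matrix n n ℂ)) i j = m
  generalize (Uᴴ * Z * V) i j = b
  generalize hT.1.eigenvalues i = τ at *
  generalize hA.1.eigenvalues j = α at *
  have hc : 0 < α + t * τ := by positivity
  have h1 : (star b * τ * m).re ≤ ‖b‖ * (τ * ‖m‖) := by
    refine (Complex.re_le_norm _).trans ?_
    rw [norm_mul, norm_mul, norm_star, Complex.norm_real, Real.norm_of_nonneg hτ.le, mul_assoc]
  rw [mul_div_assoc', le_div_iff₀ hc]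
  nlinarith [sq_nonneg ((α + t * τ) * ‖b‖ - τ * ‖m‖), mul_le_mul_of_nonneg_right h1 hc.le]

theorem Matrix.PosDef.exists_resolventFunctional_eq {T A : Matrix n n ℂ} (hT : T.PosDef)
    (hA : A.PosDef) {t : ℝ} (ht : 0 ≤ t) :
    ∃ Z, resolventFunctional t Z T A = hT.1.resolventForm hA.1 t := by
  -- The scalar quadratic is maximal at `b = τ m / (α + tτ)`.
  refine ⟨_, (hT.1.resolventFunctional_eq hA.1 t (Matrix.of fun i j =>
    ((hT.1.eigenvalues i / (hA.1.eigenvalues j + t * hT.1.eigenvalues i) : ℝ) : ℂ) *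
    (star (hT.1.eigenvectorUnitary : Matrix n n ℂ) *
      (hA.1.eigenvectorUnitary : Matrix n n ℂ)) i j)).trans ?_⟩
  rw [IsHermitian.resolventForm]
  refine Finset.sum_congr rfl fun i _ => Finset.sum_congr rfl fun j _ => ?_
  have hτ := hT.eigenvalues_pos i
  have hα := hA.eigenvalues_pos j
  unfold IsHermitian.overlap
  rw [Matrix.of_apply]
  generalize (star (hT.1.eigenvectorUnitary : Matrix n n ℂ) *
    (hA.1.eigenvectorUnitary : Matrix n n ℂ)) i j = m
  generalize hT.1.eigenvalues i = τ at *
  generalize hA.1.eigenvalues j = α at *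
  have hc : 0 < α + t * τ := by positivity
  have h2 : star (((τ / (α + t * τ) : ℝ) : ℂ) * m) * τ * m =
      ((τ / (α + t * τ) * τ * ‖m‖ ^ 2 : ℝ) : ℂ) := by
    have h := Complex.conj_mul' m
    rw [star_mul', Complex.star_def, Complex.conj_ofReal]
    push_cast
    rw [← h]
    ring
  rw [h2, Complex.ofReal_re, norm_mul, Complex.norm_real, mul_pow, Real.norm_eq_abs, sq_abs]
  field_simp
  ring

theorem Matrix.resolventFunctional_combo (t : ℝ) (Z T₁ T₂ A₁ A₂ : Matrix n n ℂ) (a b : ℝ) :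
    resolventFunctional t Z (a • T₁ + b • T₂) (a • A₁ + b • A₂) =
      a * resolventFunctional t Z T₁ A₁ + b * resolventFunctional t Z T₂ A₂ := by
  simp only [resolventFunctional, mul_add, add_mul, trace_add, Matrix.mul_smul, Matrix.smul_mul,
    trace_smul, Complex.add_re, Complex.smul_re, smul_eq_mul]
  ring

/-- A supremum of linear functionals is convex: the `Z` optimal at the combination is a competitor
at both endpoints. -/
theorem Matrix.PosDef.resolventForm_combo_le {T₁ T₂ A₁ A₂ : Matrix n n ℂ} (hT₁ : T₁.PosDef)
    (hT₂ : T₂.PosDef) (hA₁ : A₁.PosDef) (hA₂ : A₂.PosDef) {a b : ℝ} (ha : 0 ≤ a) (hb : 0 ≤ b)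
    (hT : (a • T₁ + b • T₂).PosDef) (hA : (a • A₁ + b • A₂).PosDef) {t : ℝ} (ht : 0 ≤ t) :
    hT.1.resolventForm hA.1 t ≤
      a * hT₁.1.resolventForm hA₁.1 t + b * hT₂.1.resolventForm hA₂.1 t := by
  obtain ⟨Z, hZ⟩ := hT.exists_resolventFunctional_eq hA ht
  rw [← hZ, resolventFunctional_combo]
  gcongr
  · exact hT₁.resolventFunctional_le hA₁ ht Z
  · exact hT₂.resolventFunctional_le hA₂ ht Z

namespace Matrix.IsHermitian

/-- The integral over `[0, R]` of the resolvent representation of the relative entropy. -/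
noncomputable def truncatedRelEntropy {T A : Matrix n n ℂ} (hT : T.IsHermitian)
    (hA : A.IsHermitian) (R : ℝ) : ℝ :=
  ∑ i, ∑ j, hT.overlap hA i j * (hT.eigenvalues i *
    (Real.log (hA.eigenvalues j + R * hT.eigenvalues i) - Real.log (1 + R) -
      Real.log (hA.eigenvalues j)))

theorem truncatedRelEntropy_zero {T A : Matrix n n ℂ} (hT : T.IsHermitian) (hA : A.IsHermitian) :
    hT.truncatedRelEntropy hA 0 = 0 := by
  simp [truncatedRelEntropy]

end Matrix.IsHermitian

/-- The explicit antiderivative lets a derivative and a limit stand in for the improper integral. -/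
theorem Matrix.PosDef.hasDerivAt_truncatedRelEntropy {T A : Matrix n n ℂ} (hT : T.PosDef)
    (hA : A.PosDef) {R : ℝ} (hR : 0 ≤ R) :
    HasDerivAt (hT.1.truncatedRelEntropy hA.1)
      (hT.1.resolventForm hA.1 R - (1 + R)⁻¹ * (trace T).re) R := by
  rw [hT.1.re_trace_left hA.1, IsHermitian.resolventForm]
  simp only [Finset.mul_sum, ← Finset.sum_sub_distrib]
  unfold IsHermitian.truncatedRelEntropy
  refine HasDerivAt.fun_sum fun i _ => HasDerivAt.fun_sum fun j _ => ?_
  have hτ := hT.eigenvalues_pos i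
  have hα := hA.eigenvalues_pos j
  have hc : 0 < hA.1.eigenvalues j + R * hT.1.eigenvalues i := by positivity
  have h1 : HasDerivAt (fun R => hA.1.eigenvalues j + R * hT.1.eigenvalues i)
      (hT.1.eigenvalues i) R := by
    simpa using ((hasDerivAt_id R).mul_const (hT.1.eigenvalues i)).const_add
      (hA.1.eigenvalues j)
  have h2 : HasDerivAt (fun R : ℝ => 1 + R) 1 R := (hasDerivAt_id R).const_add 1
  have h := ((((h1.log hc.ne').sub (h2.log (by positivity))).sub_const
    (Real.log (hA.1.eigenvalues j))).const_mul (hT.1.eigenvalues i)).const_mul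
    (hT.1.overlap hA.1 i j)
  refine h.congr_deriv ?_
  ring

theorem Matrix.PosDef.tendsto_truncatedRelEntropy {T A : Matrix n n ℂ} (hT : T.PosDef)
    (hA : A.PosDef) :
    Tendsto (hT.1.truncatedRelEntropy hA.1) atTop
      (𝓝 ((trace (T * CFC.log T)).re - (trace (T * CFC.log A)).re)) := by
  rw [hT.1.re_trace_mul_log hA.1, hT.1.re_trace_mul_log_self hA.1]
  simp only [← Finset.sum_sub_distrib, ← mul_sub]
  unfold IsHermitian.truncatedRelEntropy
  refine tendsto_finsetSum _ fun i _ => tendsto_finsetSum _ fun j _ => ?_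
  refine Tendsto.const_mul _ (Tendsto.const_mul _ (Tendsto.sub_const ?_ _))
  have hτ := hT.eigenvalues_pos i
  have hα := hA.eigenvalues_pos j
  generalize hT.1.eigenvalues i = τ at *
  generalize hA.1.eigenvalues j = α at *
  -- The function is `(α + Rτ) / (1 + R)`, split to show its limit `τ`.
  have hlim : Tendsto (fun R : ℝ => (α - τ) * (1 + R)⁻¹ + τ) atTop (𝓝 ((α - τ) * 0 + τ)) :=
    ((tendsto_inv_atTop_zero.comp (tendsto_atTop_add_const_left _ 1 tendsto_id)).const_mul
      _).add_const _
  rw [mul_zero, zero_add] at hlim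
  refine (hlim.log hτ.ne').congr' ?_
  filter_upwards [eventually_ge_atTop 0] with R hR
  rw [← Real.log_div (by positivity) (by positivity)]
  congr 1
  field_simp
  ring

/-- Joint convexity of the quantum relative entropy. -/
theorem Matrix.PosDef.relEntropy_combo_le {T₁ T₂ A₁ A₂ : Matrix n n ℂ} (hT₁ : T₁.PosDef)
    (hT₂ : T₂.PosDef) (hA₁ : A₁.PosDef) (hA₂ : A₂.PosDef) {a b : ℝ} (ha : 0 ≤ a) (hb : 0 ≤ b)
    (hT : (a • T₁ + b • T₂).PosDef) (hA : (a • A₁ + b • A₂).PosDef) :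
    (trace ((a • T₁ + b • T₂) * CFC.log (a • T₁ + b • T₂))).re -
        (trace ((a • T₁ + b • T₂) * CFC.log (a • A₁ + b • A₂))).re ≤
      a * ((trace (T₁ * CFC.log T₁)).re - (trace (T₁ * CFC.log A₁)).re) +
        b * ((trace (T₂ * CFC.log T₂)).re - (trace (T₂ * CFC.log A₂)).re) := by
  have hlim := (((hT₁.tendsto_truncatedRelEntropy hA₁).const_mul a).add
    ((hT₂.tendsto_truncatedRelEntropy hA₂).const_mul b)).sub (hT.tendsto_truncatedRelEntropy hA)
  rw [← sub_nonneg]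
  refine ge_of_tendsto hlim ?_
  filter_upwards [eventually_ge_atTop 0] with R hR
  set F : ℝ → ℝ := fun x => a * hT₁.1.truncatedRelEntropy hA₁.1 x +
    b * hT₂.1.truncatedRelEntropy hA₂.1 x - hT.1.truncatedRelEntropy hA.1 x with hF
  have hd : ∀ x, 0 ≤ x → HasDerivAt F
      (a * (hT₁.1.resolventForm hA₁.1 x - (1 + x)⁻¹ * (trace T₁).re) +
        b * (hT₂.1.resolventForm hA₂.1 x - (1 + x)⁻¹ * (trace T₂).re) -
        (hT.1.resolventForm hA.1 x - (1 + x)⁻¹ * (trace (a • T₁ + b • T₂)).re)) x := fun x hx =>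
    (((hT₁.hasDerivAt_truncatedRelEntropy hA₁ hx).const_mul a).add
      ((hT₂.hasDerivAt_truncatedRelEntropy hA₂ hx).const_mul b)).sub
      (hT.hasDerivAt_truncatedRelEntropy hA hx)
  -- The trace terms cancel by linearity; the derivative is the convexity gap of the resolvent form.
  have hmono : MonotoneOn F (Set.Ici 0) := by
    refine monotoneOn_of_deriv_nonneg (convex_Ici 0)
      (fun x hx => (hd x hx).continuousAt.continuousWithinAt)
      (fun x hx => (hd x ?_).differentiableAt.differentiableWithinAt) fun x hx => ?_
    · exact interior_subset hx
    · have hx' : 0 ≤ x := interior_subset (s := Set.Ici (0 : ℝ)) hx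
      rw [(hd x hx').deriv]
      have := hT₁.resolventForm_combo_le hT₂ hA₁ hA₂ ha hb hT hA hx'
      rw [trace_add, trace_smul, trace_smul, Complex.add_re, Complex.smul_re, Complex.smul_re,
        smul_eq_mul, smul_eq_mul]
      linarith
  have h0 : F 0 = 0 := by simp [hF, IsHermitian.truncatedRelEntropy_zero]
  calc 0 = F 0 := h0.symm
    _ ≤ F R := hmono Set.self_mem_Ici hR hR

/-! ### Gibbs principle, Lieb concavity and monotonicity of the trace exponential -/

theorem Matrix.IsHermitian.posDef_exp {H : Matrix n n ℂ} (hH : H.IsHermitian) :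
    (NormedSpace.exp H).PosDef := by
  rw [← isStrictlyPositive_iff_posDef, IsStrictlyPositive.iff_of_unital]
  exact ⟨hH.isSelfAdjoint.exp_nonneg, Matrix.isUnit_exp H⟩

/-- The lower bound in the Gibbs variational principle. -/
theorem Matrix.PosDef.le_re_trace_exp {T H : Matrix n n ℂ} (hT : T.PosDef) (hH : H.IsHermitian) :
    (trace (T * H)).re - (trace (T * CFC.log T)).re + (trace T).re ≤
      (trace (NormedSpace.exp H)).re := by
  simpa [CFC.log_exp H hH.isSelfAdjoint] using hT.klein hH.posDef_exp

/-- Equality in the Gibbs bound at the maximizer `T = exp H`. -/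
theorem Matrix.IsHermitian.re_trace_exp_eq {H : Matrix n n ℂ} (hH : H.IsHermitian) :
    (trace (NormedSpace.exp H)).re = (trace (NormedSpace.exp H * H)).re -
      (trace (NormedSpace.exp H * CFC.log (NormedSpace.exp H))).re +
      (trace (NormedSpace.exp H)).re := by
  simp [CFC.log_exp H hH.isSelfAdjoint]

theorem Matrix.isHermitian_log (A : Matrix n n ℂ) : (CFC.log A).IsHermitian :=
  IsSelfAdjoint.log (a := A)

/-- **Lieb's concavity theorem** for the trace exponential. -/
theorem Matrix.PosDef.lieb {H : Matrix n n ℂ} (hH : H.IsHermitian) {A₁ A₂ : Matrix n n ℂ}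
    (hA₁ : A₁.PosDef) (hA₂ : A₂.PosDef) {a b : ℝ} (ha : 0 < a) (hb : 0 < b) :
    a * (trace (NormedSpace.exp (H + CFC.log A₁))).re +
        b * (trace (NormedSpace.exp (H + CFC.log A₂))).re ≤
      (trace (NormedSpace.exp (H + CFC.log (a • A₁ + b • A₂)))).re := by
  have h₁ := hH.add (isHermitian_log A₁)
  have h₂ := hH.add (isHermitian_log A₂)
  have hT₁ := h₁.posDef_exp
  have hT₂ := h₂.posDef_exp
  -- The combination of the two maximizers is a trial matrix at `a • A₁ + b • A₂`: a partial maximum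
  -- of a jointly concave function is concave.
  have hT := (hT₁.smul ha).add (hT₂.smul hb)
  have hA := (hA₁.smul ha).add (hA₂.smul hb)
  have key := hT₁.relEntropy_combo_le hT₂ hA₁ hA₂ ha.le hb.le hT hA
  have hlow := hT.le_re_trace_exp (hH.add (isHermitian_log (a • A₁ + b • A₂)))
  refine le_trans ?_ hlow
  rw [h₁.re_trace_exp_eq, h₂.re_trace_exp_eq]
  generalize NormedSpace.exp (H + CFC.log A₁) = T₁ at *
  generalize NormedSpace.exp (H + CFC.log A₂) = T₂ at *
  generalize CFC.log (a • T₁ + b • T₂) = L at *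
  generalize CFC.log (a • A₁ + b • A₂) = L' at *
  simp only [mul_add, add_mul, trace_add, Matrix.smul_mul, trace_smul, Complex.add_re,
    Complex.smul_re, smul_eq_mul] at key ⊢
  linarith

/-- The exponential is not operator monotone, but the Gibbs bound for `B` with trial matrix `exp A`
leaves only `tr (exp A (B - A)) ≥ 0` to check. -/
theorem Matrix.IsHermitian.re_trace_exp_mono {A B : Matrix n n ℂ} (hA : A.IsHermitian)
    (hB : B.IsHermitian) (hAB : A ≤ B) :
    (trace (NormedSpace.exp A)).re ≤ (trace (NormedSpace.exp B)).re := by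
  refine le_trans ?_ (hA.posDef_exp.le_re_trace_exp hB)
  rw [CFC.log_exp A hA.isSelfAdjoint]
  have h : 0 ≤ (trace (NormedSpace.exp A * (B - A))).re := by
    set C := CFC.sqrt (NormedSpace.exp A)
    have hC : C * C = NormedSpace.exp A := CFC.sqrt_mul_sqrt_self _ hA.isSelfAdjoint.exp_nonneg
    have hC' : Cᴴ = C := (CFC.sqrt_nonneg (NormedSpace.exp A)).isSelfAdjoint
    have h2 := (Matrix.le_iff.1 hAB).conjTranspose_mul_mul_same C
    rw [← hC, mul_assoc, trace_mul_comm]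
    rw [hC'] at h2
    exact (Complex.nonneg_iff.1 h2.trace_nonneg).1
  rw [mul_sub, trace_sub, Complex.sub_re] at h
  linarith

end TraceInequalities

/-- A concave function on an open convex set has a supergradient at each point. -/
theorem ConcaveOn.exists_supergradient {E : Type*} [NormedAddCommGroup E] [NormedSpace ℝ E]
    [FiniteDimensional ℝ E] {C : Set E} (hC : IsOpen C) {f : E → ℝ} (hf : ConcaveOn ℝ C f) {x : E}
    (hx : x ∈ C) : ∃ l : StrongDual ℝ E, ∀ y ∈ C, f y ≤ f x + l (y - x) := by
  have hopen : IsOpen {p : E × ℝ | p.1 ∈ C ∧ p.2 < f p.1} := by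
    have h1 : ContinuousOn (fun p : E × ℝ => f p.1 - p.2) (Prod.fst ⁻¹' C) :=
      ((hf.continuousOn hC).comp continuousOn_fst fun p hp => hp).sub continuousOn_snd
    have h2 := h1.isOpen_inter_preimage (hC.preimage continuous_fst) (isOpen_Ioi (a := 0))
    convert h2 using 1
    ext p
    simp
  obtain ⟨L, u, hL, hu⟩ := geometric_hahn_banach_open hf.convex_strict_hypograph hopen
    (convex_singleton (x, f x)) (Set.disjoint_singleton_right.2 (by simp))
  have hu : u ≤ L (x, f x) := hu _ rfl
  have hsplit : ∀ y r, L (y, r) = L (y, 0) + r * L (0, 1) := fun y r => by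
    rw [← smul_eq_mul, ← map_smul, ← map_add]
    simp
  set c := L (0, 1) with hc
  -- The point `(x, f x - 1)` lies in the strict hypograph, so the separating hyperplane is not
  -- vertical.
  have hcpos : 0 < c := by
    have h := hL (x, f x - 1) ⟨hx, by simp⟩
    rw [hsplit] at h hu
    linarith
  refine ⟨-(c⁻¹ • L.comp (ContinuousLinearMap.inl ℝ E ℝ)), fun y hy => ?_⟩
  refine le_of_forall_lt fun r hr => ?_
  have h := hL (y, r) ⟨hy, hr⟩
  rw [hsplit] at h hu
  have hsub : L (y - x, 0) = L (y, 0) - L (x, 0) := by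
    rw [← map_sub]; simp
  have hexp : (-(c⁻¹ • L.comp (ContinuousLinearMap.inl ℝ E ℝ))) (y - x) =
      -(c⁻¹ * (L (y, 0) - L (x, 0))) := by
    simp [hsub]
  rw [hexp]
  have h3 : c * r < c * (f x + -(c⁻¹ * (L (y, 0) - L (x, 0)))) := by
    have : c * (f x + -(c⁻¹ * (L (y, 0) - L (x, 0)))) =
      c * f x - (L (y, 0) - L (x, 0)) := by field_simp; ring
    rw [this]; linarith
  exact lt_of_mul_lt_mul_left h3 hcpos.le

/-! ### Jensen's inequality and subadditivity of cumulants -/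

section LaplaceTransform

open Matrix Filter Topology
open scoped Matrix.Norms.L2Operator ComplexOrder

variable {n : Type*} [Fintype n] [DecidableEq n]

/-- The Hermitian part of a matrix, as a real-linear endomorphism. -/
noncomputable def Matrix.hermitianPart (n : Type*) [Fintype n] [DecidableEq n] :
    Matrix n n ℂ →ₗ[ℝ] Matrix n n ℂ :=
  (selfAdjoint.submodule ℝ (Matrix n n ℂ)).subtype ∘ₗ realPart

theorem Matrix.IsHermitian.hermitianPart_eq {A : Matrix n n ℂ} (hA : A.IsHermitian) :
    hermitianPart n A = A :=
  hA.isSelfAdjoint.coe_realPart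

theorem Matrix.isHermitian_hermitianPart (A : Matrix n n ℂ) : (hermitianPart n A).IsHermitian :=
  (realPart A).2

/-- For nonempty `n`, positive definite matrices have empty interior among all complex matrices;
pulling back along the Hermitian part gives the open domain that the supergradient needs. -/
theorem Matrix.isOpen_posDef_hermitianPart : IsOpen {A | (hermitianPart n A).PosDef} := by
  rcases isEmpty_or_nonempty n with hn | hn
  · have := Subsingleton.discreteTopology (α := Matrix n n ℂ)
    exact isOpen_discrete _
  rw [isOpen_iff_mem_nhds]
  intro A hA
  have hA' := isStrictlyPositive_iff_posDef.2 hA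
  obtain ⟨r, hr, hrA⟩ := (CFC.exists_pos_algebraMap_le_iff hA.1.isSelfAdjoint).2 fun x hx =>
    hA'.spectrum_pos hx
  have hcont : Continuous (hermitianPart n) := LinearMap.continuous_of_finiteDimensional _
  filter_upwards [hcont.continuousAt.preimage_mem_nhds (Metric.ball_mem_nhds _ hr)] with B hB
  rw [Set.mem_preimage, mem_ball_iff_norm] at hB
  set P := hermitianPart n B
  set Q := hermitianPart n A
  have hsa : IsSelfAdjoint (P - Q) := ((isHermitian_hermitianPart B).sub hA.1).isSelfAdjoint
  have h1 := hsa.neg_algebraMap_norm_le_self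
  have h2 : algebraMap ℝ (Matrix n n ℂ) (r - ‖P - Q‖) ≤ P := by
    have := add_le_add hrA h1
    rwa [add_sub_cancel, ← sub_eq_add_neg, ← map_sub] at this
  rw [← isStrictlyPositive_iff_posDef]
  refine IsStrictlyPositive.of_le ?_ h2
  rw [Algebra.algebraMap_eq_smul_one]
  exact isStrictlyPositive_one.smul (sub_pos.2 hB)

theorem Matrix.concaveOn_re_trace_exp_add_log {H : Matrix n n ℂ} (hH : H.IsHermitian) :
    ConcaveOn ℝ {A : Matrix n n ℂ | A.PosDef}
      fun A => (trace (NormedSpace.exp (H + CFC.log A))).re :=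
  concaveOn_iff_forall_pos.2 ⟨convex_iff_forall_pos.2 fun _ hA _ hB _ _ ha hb _ =>
    (PosDef.smul hA ha).add (PosDef.smul hB hb), fun _ hA _ hB _ _ ha hb _ =>
    PosDef.lieb hH hA hB ha hb⟩

theorem Matrix.PosDef.exists_supergradient_trace_exp {H M : Matrix n n ℂ} (hH : H.IsHermitian)
    (hM : M.PosDef) : ∃ l : Matrix n n ℂ →ₗ[ℝ] ℝ, ∀ Y : Matrix n n ℂ, Y.PosDef →
      (trace (NormedSpace.exp (H + CFC.log Y))).re ≤
        (trace (NormedSpace.exp (H + CFC.log M))).re + l (Y - M) := by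
  obtain ⟨l, hl⟩ := ((concaveOn_re_trace_exp_add_log hH).comp_linearMap
    (hermitianPart n)).exists_supergradient isOpen_posDef_hermitianPart
    (x := M) (by simpa [hM.1.hermitianPart_eq] using hM)
  refine ⟨l, fun Y hY => ?_⟩
  simpa [hM.1.hermitianPart_eq, hY.1.hermitianPart_eq] using
    hl Y (by simpa [hY.1.hermitianPart_eq] using hY)

variable {Ω : Type*} [MeasurableSpace Ω] {μ : Measure Ω} {d : ℕ}

theorem RandomMatrix.HasExpectation.integrable_linearMap {Y : Ω → Matrix (Fin d) (Fin d) ℂ}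
    (hY : RandomMatrix.HasExpectation μ Y) (l : Matrix (Fin d) (Fin d) ℂ →ₗ[ℝ] ℝ) :
    Integrable (fun ω => l (Y ω)) μ ∧ ∫ ω, l (Y ω) ∂μ = l (RandomMatrix.expectation μ Y) := by
  let L : (Fin d → Fin d → ℂ) →L[ℝ] ℝ :=
    LinearMap.toContinuousLinearMap (l ∘ₗ (Matrix.ofLinearEquiv ℝ).toLinearMap)
  have h1 : ∀ i, Integrable (fun ω => (Matrix.of.symm (Y ω)) i) μ := fun i =>
    Integrable.of_eval fun j => hY i j
  have h2 : Integrable (fun ω => Matrix.of.symm (Y ω)) μ := Integrable.of_eval h1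
  refine ⟨L.integrable_comp h2, (L.integral_comp_comm h2).trans ?_⟩
  have h3 : ∫ ω, Matrix.of.symm (Y ω) ∂μ = Matrix.of.symm (RandomMatrix.expectation μ Y) := by
    ext i j
    rw [eval_integral h1 i]
    exact eval_integral (hY i) j
  rw [h3]
  rfl

theorem RandomMatrix.isHermitian_expectation {Y : Ω → Matrix (Fin d) (Fin d) ℂ}
    (hherm : ∀ ω, (Y ω).IsHermitian) : (RandomMatrix.expectation μ Y).IsHermitian := by
  ext i j
  simp only [RandomMatrix.expectation, conjTranspose_apply, of_apply, Complex.star_def]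
  rw [← integral_conj]
  congr with ω
  exact (hherm ω).apply i j

theorem RandomMatrix.HasExpectation.posDef_expectation [IsProbabilityMeasure μ]
    {Y : Ω → Matrix (Fin d) (Fin d) ℂ} (hY : RandomMatrix.HasExpectation μ Y)
    (hpos : ∀ ω, (Y ω).PosDef) : (RandomMatrix.expectation μ Y).PosDef := by
  have hE := RandomMatrix.isHermitian_expectation (μ := μ) fun ω => (hpos ω).1
  refine Matrix.PosDef.of_dotProduct_mulVec_pos hE fun x hx => ?_
  let l : Matrix (Fin d) (Fin d) ℂ →ₗ[ℝ] ℝ :=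
    { toFun := fun A => (star x ⬝ᵥ (A *ᵥ x)).re
      map_add' := fun A B => by simp [add_mulVec]
      map_smul' := fun c A => by simp [smul_mulVec] }
  obtain ⟨hi, he⟩ := hY.integrable_linearMap l
  have hlpos : ∀ ω, 0 < l (Y ω) := fun ω =>
    (Complex.pos_iff.1 ((hpos ω).dotProduct_mulVec_pos hx)).1
  have hint : 0 < ∫ ω, l (Y ω) ∂μ := by
    rw [integral_pos_iff_support_of_nonneg (fun ω => (hlpos ω).le) hi]
    have : Function.support (fun ω => l (Y ω)) = Set.univ := by
      ext ω; simpa using (hlpos ω).ne'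
    simp [this]
  rw [he] at hint
  refine Complex.pos_iff.2 ⟨hint, ?_⟩
  exact (hE.im_star_dotProduct_mulVec_self x).symm

/-- Jensen's inequality for Lieb's concave function. -/
theorem RandomMatrix.lintegral_trace_exp_le [IsProbabilityMeasure μ]
    {H : Matrix (Fin d) (Fin d) ℂ} (hH : H.IsHermitian) {X : Ω → Matrix (Fin d) (Fin d) ℂ}
    (hX : ∀ ω, (X ω).IsHermitian)
    (hint : RandomMatrix.HasExpectation μ fun ω => NormedSpace.exp (X ω)) :
    ∫⁻ ω, ENNReal.ofReal (trace (NormedSpace.exp (H + X ω))).re ∂μ ≤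
      ENNReal.ofReal (trace (NormedSpace.exp
        (H + CFC.log (RandomMatrix.expectation μ fun ω => NormedSpace.exp (X ω))))).re := by
  set M := RandomMatrix.expectation μ fun ω => NormedSpace.exp (X ω) with hM
  have hMpos : M.PosDef := hint.posDef_expectation fun ω => (hX ω).posDef_exp
  obtain ⟨l, hl⟩ := hMpos.exists_supergradient_trace_exp hH
  -- The supergradient at the mean `M`, where the linear term has expectation zero. This integrable
  -- majorant makes integrability of the left side unnecessary.
  have hle : ∀ ω, (trace (NormedSpace.exp (H + X ω))).re ≤
      (trace (NormedSpace.exp (H + CFC.log M))).re + (l (NormedSpace.exp (X ω)) - l M) :=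
    fun ω => by
      have h := hl _ (hX ω).posDef_exp
      rwa [CFC.log_exp (X ω) (hX ω).isSelfAdjoint, map_sub] at h
  obtain ⟨hi, he⟩ := hint.integrable_linearMap l
  have hi2 := (integrable_const (μ := μ) (trace (NormedSpace.exp (H + CFC.log M))).re).add
    (hi.sub (integrable_const (l M)))
  have hpos : ∀ ω, 0 ≤ (trace (NormedSpace.exp (H + X ω))).re := fun ω =>
    (Complex.nonneg_iff.1 (hH.add (hX ω)).posDef_exp.posSemidef.trace_nonneg).1
  calc _ ≤ ∫⁻ ω, ENNReal.ofReal ((trace (NormedSpace.exp (H + CFC.log M))).re +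
        (l (NormedSpace.exp (X ω)) - l M)) ∂μ :=
        lintegral_mono fun ω => ENNReal.ofReal_le_ofReal (hle ω)
    _ = ENNReal.ofReal (∫ ω, ((trace (NormedSpace.exp (H + CFC.log M))).re +
        (l (NormedSpace.exp (X ω)) - l M)) ∂μ) :=
        (ofReal_integral_eq_lintegral_ofReal hi2
          (Eventually.of_forall fun ω => (hpos ω).trans (hle ω))).symm
    _ = _ := by
        have hi3 : Integrable (fun ω => l (NormedSpace.exp (X ω)) - l M) μ :=
          hi.sub (integrable_const _)
        rw [integral_add (integrable_const _) hi3, integral_sub hi (integrable_const _), he]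
        simp [hM]

theorem RandomMatrix.borelSpace_matrix (d : ℕ) : BorelSpace (Matrix (Fin d) (Fin d) ℂ) :=
  inferInstanceAs (BorelSpace (Fin d → Fin d → ℂ))

theorem RandomMatrix.continuous_trace_exp :
    Continuous fun A : Matrix n n ℂ => (trace (NormedSpace.exp A)).re := by
  let _ : NormedAlgebra ℚ (Matrix n n ℂ) := .restrictScalars ℚ ℂ _
  exact Complex.continuous_re.comp (Continuous.matrix_trace NormedSpace.exp_continuous)

/-- Subadditivity of matrix cumulant generating functions. -/
theorem RandomMatrix.lintegral_trace_exp_sum_le [IsProbabilityMeasure μ] {ι : Type*}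
    {X : ι → Ω → Matrix (Fin d) (Fin d) ℂ} (hmeas : ∀ k, Measurable (X k))
    (hX : ∀ k ω, (X k ω).IsHermitian) (hindep : iIndepFun X μ)
    (hint : ∀ k, RandomMatrix.HasExpectation μ fun ω => NormedSpace.exp (X k ω))
    (s : Finset ι) {H : Matrix (Fin d) (Fin d) ℂ} (hH : H.IsHermitian) :
    ∫⁻ ω, ENNReal.ofReal (trace (NormedSpace.exp (H + ∑ k ∈ s, X k ω))).re ∂μ ≤
      ENNReal.ofReal (trace (NormedSpace.exp (H + ∑ k ∈ s,
        CFC.log (RandomMatrix.expectation μ fun ω => NormedSpace.exp (X k ω))))).re := by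
  classical
  -- `H` must vary: the other summands, frozen by independence, join `H` while Jensen is applied to
  -- `X a`; then the constant `L` joins it for the induction hypothesis.
  induction s using Finset.induction_on generalizing H with
  | empty => simp
  | insert a s has ih =>
    have := RandomMatrix.borelSpace_matrix d
    set L := CFC.log (RandomMatrix.expectation μ fun ω => NormedSpace.exp (X a ω)) with hL
    let S : Ω → Matrix (Fin d) (Fin d) ℂ := fun ω => ∑ k ∈ s, X k ω
    have hSmeas : Measurable S := Finset.measurable_fun_sum s fun k _ => hmeas k
    have hSX : IndepFun (X a) S μ := by
      have h := (hindep.indepFun_finsetSum_of_notMem hmeas has).symm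
      convert h using 1
      ext ω : 1
      simp [S]
    have hF : Measurable fun p : Matrix (Fin d) (Fin d) ℂ × Matrix (Fin d) (Fin d) ℂ =>
        ENNReal.ofReal (trace (NormedSpace.exp (H + p.2 + p.1))).re := by
      refine ENNReal.measurable_ofReal.comp (continuous_trace_exp.measurable.comp ?_)
      exact (measurable_const.add measurable_snd).add measurable_fst
    have hprob := hSX.map_prod_eq_prod_map_map (hmeas a).aemeasurable hSmeas.aemeasurable
    have := Measure.isProbabilityMeasure_map (μ := μ) (hmeas a).aemeasurable
    have := Measure.isProbabilityMeasure_map (μ := μ) hSmeas.aemeasurable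
    calc _ = ∫⁻ ω, ENNReal.ofReal (trace (NormedSpace.exp (H + S ω + X a ω))).re ∂μ := by
          refine lintegral_congr fun ω => ?_
          rw [Finset.sum_insert has, add_comm (X a ω), add_assoc]
      _ = ∫⁻ p, ENNReal.ofReal (trace (NormedSpace.exp (H + p.2 + p.1))).re
            ∂((μ.map (X a)).prod (μ.map S)) := by
          rw [← hprob, lintegral_map hF ((hmeas a).prodMk hSmeas)]
      _ = ∫⁻ ω', ∫⁻ ω, ENNReal.ofReal (trace (NormedSpace.exp (H + S ω' + X a ω))).re ∂μ ∂μ := by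
          rw [lintegral_prod_symm' _ hF, lintegral_map hF.lintegral_prod_left' hSmeas]
          refine lintegral_congr fun ω' => ?_
          exact lintegral_map (hF.comp (measurable_id.prodMk measurable_const)) (hmeas a)
      _ ≤ ∫⁻ ω', ENNReal.ofReal (trace (NormedSpace.exp (H + L + S ω'))).re ∂μ := by
          refine lintegral_mono fun ω' => ?_
          have hS : (S ω').IsHermitian := by
            exact isSelfAdjoint_sum s fun k _ => (hX k ω').isSelfAdjoint
          refine (lintegral_trace_exp_le (hH.add hS) (hX a) (hint a)).trans_eq ?_
          rw [add_right_comm]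
      _ ≤ _ := by
          refine (ih (hH.add (isHermitian_log _))).trans_eq ?_
          rw [Finset.sum_insert has, add_assoc]

end LaplaceTransform

/-! ### Eigenvalue bounds and the matrix Laplace transform -/

section EigenvalueBounds

open Matrix Filter Topology
open scoped Matrix.Norms.L2Operator ComplexOrder

variable {d : ℕ}

theorem RandomMatrix.le_algebraMap_lambdaMax (hd : 0 < d) {A : Matrix (Fin d) (Fin d) ℂ}
    (hA : A.IsHermitian) : A ≤ algebraMap ℝ _ (RandomMatrix.lambdaMax A) :=
  le_algebraMap_of_spectrum_le (fun _ hx => (isGreatest_lambdaMax hd hA).2 hx) hA.isSelfAdjoint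

theorem RandomMatrix.algebraMap_lambdaMin_le (hd : 0 < d) {A : Matrix (Fin d) (Fin d) ℂ}
    (hA : A.IsHermitian) : algebraMap ℝ _ (RandomMatrix.lambdaMin A) ≤ A :=
  algebraMap_le_of_le_spectrum (fun _ hx => (isLeast_lambdaMin hd hA).2 hx) hA.isSelfAdjoint

theorem Matrix.isHermitian_algebraMap (c : ℝ) :
    (algebraMap ℝ (Matrix (Fin d) (Fin d) ℂ) c).IsHermitian :=
  IsSelfAdjoint.algebraMap _ (IsSelfAdjoint.all c)

theorem Matrix.re_trace_exp_algebraMap (c : ℝ) :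
    (trace (NormedSpace.exp (algebraMap ℝ (Matrix (Fin d) (Fin d) ℂ) c))).re =
      d * Real.exp c := by
  rw [← CFC.real_exp_eq_normedSpace_exp (isHermitian_algebraMap c).isSelfAdjoint,
    cfc_algebraMap, algebraMap_eq_diagonal, trace_diagonal]
  simp [Complex.exp_ofReal_re]

theorem Matrix.smul_le_algebraMap {A : Matrix (Fin d) (Fin d) ℂ} {c r : ℝ}
    (hA : A ≤ algebraMap ℝ _ c) (hr : 0 ≤ r) : r • A ≤ algebraMap ℝ _ (r * c) := by
  rw [map_mul, ← Algebra.smul_def]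
  exact smul_le_smul_of_nonneg_left hA hr

/-- The matrix Laplace transform bound at a fixed parameter. -/
theorem RandomMatrix.measureReal_lambdaMax_le {Ω : Type*} [MeasurableSpace Ω] (μ : Measure Ω)
    [IsProbabilityMeasure μ] {ι : Type*} [Fintype ι] (hd : 0 < d)
    {X : ι → Ω → Matrix (Fin d) (Fin d) ℂ} (hmeas : ∀ k, Measurable (X k))
    (hX : ∀ k ω, (X k ω).IsHermitian) (hindep : iIndepFun X μ)
    {A : ι → Matrix (Fin d) (Fin d) ℂ} (hA : ∀ k, (A k).IsHermitian) {θ γ : ℝ} (hθ : 0 < θ)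
    (hint : ∀ k, RandomMatrix.HasExpectation μ (fun ω => NormedSpace.exp ((-θ) • X k ω)))
    (hmgf : ∀ k, RandomMatrix.expectation μ (fun ω => NormedSpace.exp ((-θ) • X k ω))
        ≤ NormedSpace.exp (γ • A k)) {c : ℝ} (hc : γ • ∑ k, A k ≤ algebraMap ℝ _ c) (ε : ℝ) :
    μ.real {ω | RandomMatrix.lambdaMax (∑ k, X k ω) ≤ ε} ≤ Real.exp (θ * ε + c) := by
  have := RandomMatrix.borelSpace_matrix d
  have hsm : ∀ (r : ℝ) {B : Matrix (Fin d) (Fin d) ℂ}, B.IsHermitian → (r • B).IsHermitian :=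
    fun r B hB => (IsSelfAdjoint.all r).smul hB.isSelfAdjoint
  have hθX : ∀ k ω, ((-θ) • X k ω).IsHermitian := fun k ω => hsm _ (hX k ω)
  have hS : ∀ ω, (∑ k, X k ω).IsHermitian := fun ω =>
    isSelfAdjoint_sum _ fun k _ => (hX k ω).isSelfAdjoint
  have hmeas' : ∀ k, Measurable fun ω => (-θ) • X k ω := fun k => (hmeas k).fun_const_smul _
  have hindep' : iIndepFun (fun k ω => (-θ) • X k ω) μ :=
    hindep.comp (fun _ B => (-θ) • B) fun _ => measurable_const_smul _
  set E := fun k => RandomMatrix.expectation μ fun ω => NormedSpace.exp ((-θ) • X k ω) with hE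
  have hsub := RandomMatrix.lintegral_trace_exp_sum_le hmeas' hθX hindep' hint Finset.univ
    (Matrix.isHermitian_zero)
  simp only [zero_add] at hsub
  have hEpos : ∀ k, (E k).PosDef := fun k =>
    (hint k).posDef_expectation fun ω => (hθX k ω).posDef_exp
  have hlog : ∀ k, CFC.log (E k) ≤ γ • A k := fun k => by
    have h := CFC.log_le_log (hmgf k) (isStrictlyPositive_iff_posDef.2 (hEpos k))
    rwa [CFC.log_exp _ (hsm γ (hA k)).isSelfAdjoint] at h
  have hsumlog : ∑ k, CFC.log (E k) ≤ algebraMap ℝ _ c := by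
    refine le_trans ?_ hc
    rw [Finset.smul_sum]
    exact Finset.sum_le_sum fun k _ => hlog k
  have hupper : (trace (NormedSpace.exp (∑ k, CFC.log (E k)))).re ≤ d * Real.exp c := by
    rw [← re_trace_exp_algebraMap]
    exact IsHermitian.re_trace_exp_mono
      (isSelfAdjoint_sum _ fun k _ => isHermitian_log (E k)) (isHermitian_algebraMap c) hsumlog
  -- Bounding all `d` eigenvalues, not just one, yields the factor `d` that cancels the one in
  -- `hupper`.
  have hlower : ∀ ω, RandomMatrix.lambdaMax (∑ k, X k ω) ≤ ε →
      d * Real.exp (-(θ * ε)) ≤ (trace (NormedSpace.exp (∑ k, (-θ) • X k ω))).re := by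
    intro ω hω
    rw [← re_trace_exp_algebraMap, ← Finset.smul_sum]
    refine IsHermitian.re_trace_exp_mono (isHermitian_algebraMap _) (hsm _ (hS ω)) ?_
    have h1 : ∑ k, X k ω ≤ algebraMap ℝ _ ε :=
      (RandomMatrix.le_algebraMap_lambdaMax hd (hS ω)).trans (algebraMap_mono _ hω)
    rw [map_neg, neg_smul]
    exact neg_le_neg (smul_le_algebraMap h1 hθ.le)
  have hd' : (0 : ℝ) < d := Nat.cast_pos.2 hd
  have hmF : Measurable fun ω =>
      ENNReal.ofReal (trace (NormedSpace.exp (∑ k, (-θ) • X k ω))).re :=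
    ENNReal.measurable_ofReal.comp (RandomMatrix.continuous_trace_exp.measurable.comp
      (Finset.measurable_fun_sum _ fun k _ => hmeas' k))
  have hmarkov := mul_meas_ge_le_lintegral (μ := μ) hmF
    (ENNReal.ofReal (d * Real.exp (-(θ * ε))))
  have hset : μ {ω | RandomMatrix.lambdaMax (∑ k, X k ω) ≤ ε} ≤
      μ {ω | ENNReal.ofReal (d * Real.exp (-(θ * ε))) ≤
        ENNReal.ofReal (trace (NormedSpace.exp (∑ k, (-θ) • X k ω))).re} :=
    measure_mono fun ω hω => ENNReal.ofReal_le_ofReal (hlower ω hω)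
  have hfinal : ENNReal.ofReal (d * Real.exp (-(θ * ε))) *
      μ {ω | RandomMatrix.lambdaMax (∑ k, X k ω) ≤ ε} ≤ ENNReal.ofReal (d * Real.exp c) :=
    (mul_le_mul_right hset _).trans
      (hmarkov.trans (hsub.trans (ENNReal.ofReal_le_ofReal hupper)))
  have hreal := ENNReal.toReal_mono ENNReal.ofReal_ne_top hfinal
  rw [ENNReal.toReal_mul, ENNReal.toReal_ofReal (by positivity),
    ENNReal.toReal_ofReal (by positivity), mul_assoc] at hreal
  have hreal' := le_of_mul_le_mul_left hreal hd'
  rw [Real.exp_neg, inv_mul_le_iff₀ (Real.exp_pos _), ← Real.exp_add] at hreal'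
  exact hreal'

end EigenvalueBounds

theorem mainTheorem2 {Ω : Type*} [MeasurableSpace Ω] (μ : Measure Ω) [IsProbabilityMeasure μ]
    (d K : ℕ) (hd : 0 < d)
    (X : Fin K → Ω → Matrix (Fin d) (Fin d) ℂ)
    (hXmeas : ∀ k, Measurable (X k))
    (hXherm : ∀ k ω, (X k ω).IsHermitian)
    (hXindep : iIndepFun X μ)
    (g : ℝ → ℝ)
    (A : Fin K → Matrix (Fin d) (Fin d) ℂ)
    (hA : ∀ k, (A k).IsHermitian)
    (hint : ∀ θ : ℝ, 0 < θ → ∀ k,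
      RandomMatrix.HasExpectation μ (fun ω => NormedSpace.exp ((-θ) • X k ω)))
    (hmgf : ∀ θ : ℝ, 0 < θ → ∀ k,
      RandomMatrix.expectation μ (fun ω => NormedSpace.exp ((-θ) • X k ω))
        ≤ NormedSpace.exp (g θ • A k)) :
    ((∀ θ : ℝ, 0 < θ → 0 < g θ) → ∀ ε : ℝ, 0 < ε →
      μ.real {ω | RandomMatrix.lambdaMax (∑ k, X k ω) ≤ ε}
        ≤ ⨅ θ : Set.Ioi (0 : ℝ),
            Real.exp ((θ : ℝ) * ε + g θ * RandomMatrix.lambdaMax (∑ k, A k))) ∧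
    ((∀ θ : ℝ, 0 < θ → g θ < 0) → ∀ ε : ℝ, 0 < ε →
      μ.real {ω | RandomMatrix.lambdaMax (∑ k, X k ω) ≤ ε}
        ≤ ⨅ θ : Set.Ioi (0 : ℝ),
            Real.exp ((θ : ℝ) * ε + g θ * RandomMatrix.lambdaMin (∑ k, A k))) := by

  refine ⟨fun hg ε _ => le_ciInf fun θ => ?_, fun hg ε _ => le_ciInf fun θ => ?_⟩
  · refine RandomMatrix.measureReal_lambdaMax_le μ hd hXmeas hXherm hXindep hA θ.2
      (hint θ θ.2) (hmgf θ θ.2) ?_ ε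
    exact Matrix.smul_le_algebraMap (RandomMatrix.le_algebraMap_lambdaMax hd
      (isSelfAdjoint_sum _ fun k _ => (hA k).isSelfAdjoint)) (hg θ θ.2).le
  · refine RandomMatrix.measureReal_lambdaMax_le μ hd hXmeas hXherm hXindep hA θ.2
      (hint θ θ.2) (hmgf θ θ.2) ?_ ε
    -- As `g θ < 0`, the bound on `-∑ A_k` by `-λ_min` is scaled by `-g θ ≥ 0`.
    have h := neg_le_neg (RandomMatrix.algebraMap_lambdaMin_le hd
      (isSelfAdjoint_sum Finset.univ fun k _ => (hA k).isSelfAdjoint))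
    rw [← map_neg] at h
    simpa using Matrix.smul_le_algebraMap h (neg_nonneg.2 (hg θ θ.2).le)
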